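/- Let $n\ge 1$. Let $\mathcal C_n(\mathbb R)$ be the real associative algebra generated by $i_1,\dots,i_{n-1}$ subject to $i_h^2=-1$ and $i_hi_k=-i_ki_h$ for $h\ne k$, so that $\mathcal C_n(\mathbb R)\subset \mathcal C_{n+1}(\mathbb R)$. It has as a basis the products $I=i_{j_1}\cdots i_{j_r}$ with $j_1<\dots<j_r$. For $a=\sum_I a_I I$ put $|a|^2=\sum_I a_I^2$ and let $\mathrm{Re}(a)$ be the coefficient of $a$ at $1$. Let $a\mapsto a'$ be the automorphism with $i_h\mapsto -i_h$, let $a\mapsto a^*$ be the anti-automorphism that reverses products of generators, and put $\overline a=(a')^*$. Let $\mathbb V^n(\mathbb R)$ be the space of vectors $a_0+a_1i_1+\dots+a_{n-1}i_{n-1}$, and let $\Gamma_n(\mathbb R)$ be the group of all products of invertible vectors. Let $\mathrm{SL}_+(\Gamma_n(\mathbb R))$ be the group of matrices $\begin{pmatrix}\alpha&\beta\\ \gamma&\delta\end{pmatrix}$ with entries in $\Gamma_n(\mathbb R)\cup\{0\}$ such that $\alpha\beta^*,\gamma\delta^*,\gamma^*\alpha,\delta^*\beta\in\mathbb V^n(\mathbb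 R)$ and $\alpha\delta^*-\beta\gamma^*=1$, and let $\mathrm{SU}_+(\Gamma_n(\mathbb R))$ be the set of its elements of the form $\begin{pmatrix}\alpha&\gamma\\ -\gamma'&\alpha'\end{pmatrix}$. Let $\mathbb H^{n+1}=\{z_0+z_1i_1+\dots+z_ni_n\in\mathbb V^{n+1}(\mathbb R) : z_n>0\}$ with its hyperbolic distance $\rho$, given by $\cosh\rho(z,w)=1+\frac{|z-w|^2}{2z_nw_n}$. The group $\mathrm{SL}_+(\Gamma_n(\mathbb R))$ acts on it by $\begin{pmatrix}\alpha&\beta\\ \gamma&\delta\end{pmatrix}z=(\alpha z+\beta)(\gamma z+\delta)^{-1}$, computed in $\mathcal C_{n+1}(\mathbb R)$. Put $\Sigma_{M}(p)=\{z\in\mathbb H^{n+1} : \rho(p,z)=\rho(z,M(p))\}$. Theorem. Let $M=\begin{pmatrix}\alpha&\beta\\ \gamma&\delta\end{pmatrix}\in \mathrm{SL}_+(\Gamma_n(\mathbb R))\setminus \mathrm{SU}_+(\Gamma_n(\mathbb R))$ and put $v=\beta^*\alpha'+\delta^*\gamma'$. Then $v\in\mathbb V^n(\mathbb R)$, and the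 following hold. 1. $\Sigma_{M^{-1}}(i_n)$ is a Euclidean half-sphere (the part in $\mathbb H^{n+1}$ of a Euclidean sphere of positive radius centred at a point of $\mathbb V^n(\mathbb R)$) if and only if $|\alpha|^2+|\gamma|^2\neq 1$. In this case its centre is $P=\frac{-(\beta^*\alpha'+\delta^*\gamma')}{|\alpha|^2+|\gamma|^2-1}\in\mathbb V^n(\mathbb R)$ and its radius $R>0$ is given by $R^2=\frac{1+|P|^2}{|\alpha|^2+|\gamma|^2}$. 2. $\Sigma_{M^{-1}}(i_n)$ is a hyperplane (the nonempty intersection of $\mathbb H^{n+1}$ with a Euclidean hyperplane of $\mathbb V^{n+1}(\mathbb R)$) if and only if $|\alpha|^2+|\gamma|^2=1$. In this case $\Sigma_{M^{-1}}(i_n)=\{z\in\mathbb H^{n+1} : \mathrm{Re}(\overline v z)+\frac{|v|^2}{2}=0\}$. -/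

import Mathlib

noncomputable section

namespace VahlenBisector

/-- The negative definite quadratic form `x ↦ -(x₁² + ⋯ + x_m²)` on `ℝ^m`. -/
def negForm (m : ℕ) : QuadraticForm ℝ (Fin m → ℝ) :=
  QuadraticMap.weightedSumSquares ℝ (fun _ : Fin m => (-1 : ℝ))

/-- The real Clifford algebra with `m` generators `i₁, …, i_m`, subject to `i_h² = -1` and
`i_h i_k = - i_k i_h` for `h ≠ k`. With `n = m + 1` this is the algebra usually written `𝒞_n(ℝ)`,
which has `n - 1` generators. -/
abbrev Cliff (m : ℕ) : Type := CliffordAlgebra (negForm m)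

/-- The generators. `gen m k` is `i_{k+1}`, as `Fin m` starts at `0`. -/
def gen (m : ℕ) (k : Fin m) : Cliff m := CliffordAlgebra.ι (negForm m) (Pi.single k 1)

/-- The product of the generators `i_k`, `k ∈ I`, taken in increasing order of the indices. -/
def monomial (m : ℕ) (I : Finset (Fin m)) : Cliff m := ((I.sort (· ≤ ·)).map (gen m)).prod

theorem gen_sq (m : ℕ) (k : Fin m) : gen m k * gen m k = -1 := by
  unfold gen
  have h : negForm m (Pi.single k 1) = -1 := by simp [negForm, Pi.single_apply]
  rw [CliffordAlgebra.ι_sq_scalar, h, map_neg, map_one]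

theorem polar_single (m : ℕ) (h k : Fin m) (hk : h ≠ k) :
    QuadraticMap.polar (negForm m) (Pi.single h 1) (Pi.single k 1) = 0 := by
  simp only [QuadraticMap.polar, negForm, QuadraticMap.weightedSumSquares_apply, Pi.add_apply,
    smul_eq_mul, ← Finset.sum_sub_distrib]
  refine Finset.sum_eq_zero fun i _ => ?_
  by_cases h1 : i = h
  · subst h1
    simp [Pi.single_eq_of_ne hk]
  · simp [Pi.single_eq_of_ne h1]

theorem gen_anticomm (m : ℕ) (h k : Fin m) (hk : h ≠ k) :
    gen m h * gen m k = -(gen m k * gen m h) := by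
  unfold gen
  rw [eq_neg_iff_add_eq_zero, CliffordAlgebra.ι_mul_ι_add_swap, polar_single m h k hk, map_zero]

/-- The monomials, transported to the exterior algebra, are the standard basis vectors there. -/
theorem equivExterior_monomial (m : ℕ) (I : Finset (Fin m)) :
    CliffordAlgebra.equivExterior (negForm m) (monomial m I)
      = (Pi.basisFun ℝ (Fin m)).ExteriorAlgebra I := by
  have key : ∀ l : List (Fin m), l.Nodup →
      CliffordAlgebra.equivExterior (negForm m) ((l.map (gen m)).prod)
        = (l.map fun k => ExteriorAlgebra.ι ℝ (Pi.basisFun ℝ (Fin m) k)).prod := by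
    have contr : ∀ (d : Module.Dual ℝ (Fin m → ℝ)) (l : List (Fin m)),
        (∀ k ∈ l, d (Pi.single k 1) = 0) →
        CliffordAlgebra.contractLeft (Q := (0 : QuadraticForm ℝ (Fin m → ℝ))) d
          ((l.map fun k => ExteriorAlgebra.ι ℝ (Pi.basisFun ℝ (Fin m) k)).prod) = 0 := by
      intro d l
      induction l with
      | nil =>
        intro _
        simp only [List.map_nil, List.prod_nil]
        exact CliffordAlgebra.contractLeft_one (Q := 0) d
      | cons a l ih =>
        intro h
        simp only [List.map_cons, List.prod_cons]
        refine (CliffordAlgebra.contractLeft_ι_mul d _ _).trans ?_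
        rw [ih fun k hk => h k (List.mem_cons_of_mem _ hk)]
        simp [h a List.mem_cons_self]
    intro l
    induction l with
    | nil =>
      intro _
      simp only [List.map_nil, List.prod_nil]
      exact CliffordAlgebra.changeForm_one CliffordAlgebra.changeForm.associated_neg_proof
    | cons a l ih =>
      intro h
      rw [List.nodup_cons] at h
      simp only [List.map_cons, List.prod_cons]
      refine (CliffordAlgebra.changeForm_ι_mul
        CliffordAlgebra.changeForm.associated_neg_proof _ _).trans ?_
      have ih' := ih h.2
      simp only [CliffordAlgebra.equivExterior, CliffordAlgebra.changeFormEquiv_apply] at ih'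
      rw [ih', contr _ l, sub_zero, Pi.basisFun_apply]
      intro k hk
      have hak : a ≠ k := fun e => h.1 (e ▸ hk)
      have h0 := polar_single m a k hak
      simp only [QuadraticMap.polar] at h0
      simp [QuadraticMap.associated_apply, h0]
  rw [monomial, key _ (I.sort_nodup _), ExteriorAlgebra.basis_apply_ofCard _ rfl]
  refine Eq.trans ?_ (ExteriorAlgebra.ιMulti_apply _).symm
  congr 1
  rw [← Finset.listMap_orderEmbOfFin_finRange I rfl, List.map_map, List.ofFn_eq_map]
  rfl

/-- The basis of the Clifford algebra that consists of the monomials `i_{j₁} ⋯ i_{j_r}` with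
`j₁ < ⋯ < j_r`; see `basis_apply`. -/
def basis (m : ℕ) : Module.Basis (Finset (Fin m)) ℝ (Cliff m) :=
  (Pi.basisFun ℝ (Fin m)).ExteriorAlgebra.map
    (CliffordAlgebra.equivExterior (negForm m)).symm

theorem basis_apply (m : ℕ) (I : Finset (Fin m)) : basis m I = monomial m I := by
  rw [basis, Module.Basis.map_apply, LinearEquiv.symm_apply_eq, equivExterior_monomial]

/-- The coefficient of `a` at the monomial indexed by `I`. -/
def coeff {m : ℕ} (I : Finset (Fin m)) (a : Cliff m) : ℝ := (basis m).repr a I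

/-- The real part of `a`: its coefficient at the monomial `1`. -/
def re {m : ℕ} (a : Cliff m) : ℝ := coeff ∅ a

/-- `|a|²`, the sum of the squares of the coefficients of `a` at the monomials. -/
def normSq {m : ℕ} (a : Cliff m) : ℝ := ∑ I : Finset (Fin m), coeff I a ^ 2

/-- The main conjugation `a ↦ a'`, the automorphism that replaces each `i_h` by `-i_h`. -/
def prim {m : ℕ} (a : Cliff m) : Cliff m := CliffordAlgebra.involute a

/-- The reversion `a ↦ a*`, the anti-automorphism that reverses products of generators. -/
def rev {m : ℕ} (a : Cliff m) : Cliff m := CliffordAlgebra.reverse a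

/-- The conjugation `a ↦ ā = (a')*`. -/
def conj {m : ℕ} (a : Cliff m) : Cliff m := rev (prim a)

/-- The Clifford vectors `a₀ + a₁ i₁ + ⋯ + a_m i_m`; with `n = m + 1` this is the space
`𝕍^n(ℝ)`, of dimension `n`. -/
def vectors (m : ℕ) : Submodule ℝ (Cliff m) :=
  Submodule.span ℝ (insert 1 (Set.range (gen m)))

/-- The Clifford group `Γ_n(ℝ)` (`n = m + 1`): all products of invertible vectors. -/
def cliffordGroup (m : ℕ) : Submonoid (Cliff m) :=
  Submonoid.closure {a | a ∈ vectors m ∧ IsUnit a}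

/-- `GL(Γ_n(ℝ))` with `n = m + 1`. -/
structure IsGL {m : ℕ} (M : Matrix (Fin 2) (Fin 2) (Cliff m)) : Prop where
  entries : ∀ i j, M i j ∈ cliffordGroup m ∨ M i j = 0
  det_ne_zero : M 0 0 * rev (M 1 1) - M 0 1 * rev (M 1 0) ≠ 0
  vec_ab : M 0 0 * rev (M 0 1) ∈ vectors m
  vec_cd : M 1 0 * rev (M 1 1) ∈ vectors m
  vec_ca : rev (M 1 0) * M 0 0 ∈ vectors m
  vec_db : rev (M 1 1) * M 0 1 ∈ vectors m

/-- `SL₊(Γ_n(ℝ))` with `n = m + 1`. -/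
def SLplus (m : ℕ) : Set (Matrix (Fin 2) (Fin 2) (Cliff m)) :=
  {M | IsGL M ∧ M 0 0 * rev (M 1 1) - M 0 1 * rev (M 1 0) = 1}

/-- `SU₊(Γ_n(ℝ))` with `n = m + 1`: the elements of `SL₊(Γ_n(ℝ))` of the form
`(α, γ; -γ', α')`. -/
def SUplus (m : ℕ) : Set (Matrix (Fin 2) (Fin 2) (Cliff m)) :=
  SLplus m ∩ {M | ∃ α γ : Cliff m, (α ∈ cliffordGroup m ∨ α = 0) ∧
    (γ ∈ cliffordGroup m ∨ γ = 0) ∧ M = !![α, γ; -prim γ, prim α]}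

/-- The isometric inclusion `ℝ^m → ℝ^(m+1)`, `x ↦ (x, 0)`. -/
def inclIsometry (m : ℕ) : negForm m →qᵢ negForm (m + 1) where
  toFun x := Fin.snoc (α := fun _ => ℝ) x 0
  map_add' x y := by
    ext i
    refine Fin.lastCases ?_ (fun j => ?_) i <;> simp
  map_smul' c x := by
    ext i
    refine Fin.lastCases ?_ (fun j => ?_) i <;> simp
  map_app' x := by
    simp [negForm, Fin.sum_univ_castSucc]

/-- The inclusion of the Clifford algebra with generators `i₁, …, i_m` into the one with
generators `i₁, …, i_{m+1}`. -/
def incl {m : ℕ} : Cliff m →ₐ[ℝ] Cliff (m + 1) := CliffordAlgebra.map (inclIsometry m)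

theorem incl_gen (m : ℕ) (k : Fin m) : incl (gen m k) = gen (m + 1) k.castSucc := by
  unfold incl gen
  rw [CliffordAlgebra.map_apply_ι]
  congr 1
  funext i
  change Fin.snoc (α := fun _ => ℝ) (Pi.single k 1 : Fin m → ℝ) 0 i = _
  refine Fin.lastCases ?_ (fun j => ?_) i
  · simp
  · simp [Pi.single_apply]

/-- `i_n`, where `n = m + 1`: the last generator of `Cliff (m + 1)`. -/
def lastGen (m : ℕ) : Cliff (m + 1) := gen (m + 1) (Fin.last m)

/-- The last coordinate `z_n` of `z = z₀ + z₁ i₁ + ⋯ + z_n i_n`, where `n = m + 1`. -/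
def height {m : ℕ} (z : Cliff (m + 1)) : ℝ := coeff {Fin.last m} z

/-- The upper half-space `ℍ^{n+1} = {z₀ + z₁ i₁ + ⋯ + z_n i_n | z_n > 0}`, where `n = m + 1`. -/
def upperHalfSpace (m : ℕ) : Set (Cliff (m + 1)) := {z | z ∈ vectors (m + 1) ∧ 0 < height z}

/-- The hyperbolic distance of the upper half-space:
`cosh ρ(z, w) = 1 + |z - w|² / (2 z_n w_n)`. -/
def hypDist {m : ℕ} (z w : Cliff (m + 1)) : ℝ :=
  Real.arcosh (1 + normSq (z - w) / (2 * height z * height w))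

/-- The Möbius action `M z = (α z + β) (γ z + δ)⁻¹`, computed in `Cliff (m + 1)`. -/
def mobius {m : ℕ} (M : Matrix (Fin 2) (Fin 2) (Cliff m)) (z : Cliff (m + 1)) : Cliff (m + 1) :=
  (incl (M 0 0) * z + incl (M 0 1)) * Ring.inverse (incl (M 1 0) * z + incl (M 1 1))

/-- The bisector `Σ_M(p) = {z ∈ ℍ^{n+1} | ρ(p, z) = ρ(z, M p)}`. -/
def bisector {m : ℕ} (M : Matrix (Fin 2) (Fin 2) (Cliff m)) (p : Cliff (m + 1)) :
    Set (Cliff (m + 1)) :=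
  {z ∈ upperHalfSpace m | hypDist p z = hypDist z (mobius M p)}

/-- The part in `ℍ^{n+1}` of the Euclidean sphere of radius `R` around the point `c` of the
boundary `𝕍^n(ℝ)`. -/
def halfSphere {m : ℕ} (c : Cliff m) (R : ℝ) : Set (Cliff (m + 1)) :=
  {z ∈ upperHalfSpace m | normSq (z - incl c) = R ^ 2}

/-- Euclidean half-spheres of `ℍ^{n+1}`, centred on the boundary. -/
def IsHalfSphere {m : ℕ} (S : Set (Cliff (m + 1))) : Prop :=
  ∃ c ∈ vectors m, ∃ R : ℝ, 0 < R ∧ S = halfSphere c R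

/-- Nonempty intersections of `ℍ^{n+1}` with a Euclidean hyperplane `⟨u, z⟩ = Re(ū z) = t`
of `𝕍^{n+1}(ℝ)`. -/
def IsHyperplane {m : ℕ} (S : Set (Cliff (m + 1))) : Prop :=
  S.Nonempty ∧ ∃ u ∈ vectors (m + 1), u ≠ 0 ∧ ∃ t : ℝ,
    S = {z ∈ upperHalfSpace m | re (conj u * z) = t}

end VahlenBisector

end

/-!
The identity `M⁻¹ i_n = (i_n - v) / s` with `s = |α|² + |γ|²` reduces the theorem to the bisector
of two explicit points of the upper half-space. As `cosh ρ(z, w) = 1 + |z - w|² / (2 z_n w_n)`, the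
bisector of two points `p`, `q` of heights `t`, `u` is the Apollonius locus
`u |z - p|² = t |z - q|²`: a half-sphere centred on the boundary if `t ≠ u`, a vertical hyperplane
if `t = u`. Finally, `M⁻¹` fixes `i_n` only if `M` lies in `SU₊`, since then `(ᾱ, γ̄) M = (1, 0)`
forces the row `(ᾱ, γ̄)` to be the first row `(δ*, -β*)` of `M⁻¹`.
-/

noncomputable section

namespace VahlenBisector

open CliffordAlgebra
open scoped symmDiff Matrix

/-! ### Paravectors -/

section Paravectors

variable {R V : Type*} [CommRing R] [AddCommGroup V] [Module R V] {Q : QuadraticForm R V}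

/-- The sums of a scalar and a vector in a Clifford algebra; for `negForm m` they are the Clifford
vectors `vectors m`. -/
def paravectors (Q : QuadraticForm R V) : Submodule R (CliffordAlgebra Q) :=
  1 ⊔ LinearMap.range (ι Q)

theorem mem_paravectors_iff {a : CliffordAlgebra Q} :
    a ∈ paravectors Q ↔ ∃ r x, algebraMap R _ r + ι Q x = a := by
  simp [paravectors, Submodule.mem_sup, Submodule.mem_one]

theorem reverse_of_mem_paravectors {a : CliffordAlgebra Q} (ha : a ∈ paravectors Q) :
    reverse a = a := by
  obtain ⟨r, x, rfl⟩ := mem_paravectors_iff.1 ha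
  simp

theorem star_mem_paravectors {a : CliffordAlgebra Q} (ha : a ∈ paravectors Q) :
    star a ∈ paravectors Q := by
  obtain ⟨r, x, rfl⟩ := mem_paravectors_iff.1 ha
  exact mem_paravectors_iff.2 ⟨r, -x, by simp⟩

theorem exists_star_mul_self_of_mem_paravectors {a : CliffordAlgebra Q} (ha : a ∈ paravectors Q) :
    ∃ c : R, star a * a = algebraMap R _ c := by
  obtain ⟨r, x, rfl⟩ := mem_paravectors_iff.1 ha
  refine ⟨r * r - Q x, ?_⟩
  rw [star_add, star_algebraMap, star_ι, add_mul, mul_add, mul_add, neg_mul, neg_mul, ι_sq_scalar,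
    ← Algebra.commutes r (ι Q x), map_sub, map_mul]
  abel

theorem exists_mul_add_star_mul_star {a b : CliffordAlgebra Q} (ha : a ∈ paravectors Q)
    (hb : b ∈ paravectors Q) : ∃ c : R, a * b + star b * star a = algebraMap R _ c := by
  obtain ⟨r, x, rfl⟩ := mem_paravectors_iff.1 ha
  obtain ⟨s, y, rfl⟩ := mem_paravectors_iff.1 hb
  refine ⟨r * s + s * r + QuadraticMap.polar Q x y, ?_⟩
  rw [map_add, map_add, map_mul, map_mul, ← ι_mul_ι_add_swap]
  simp only [star_add, star_algebraMap, star_ι, mul_add, add_mul, neg_mul, mul_neg,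
    ← Algebra.commutes r, ← Algebra.commutes s (ι Q x)]
  abel

theorem mul_mul_self_mem_paravectors {a b : CliffordAlgebra Q} (ha : a ∈ paravectors Q)
    (hb : b ∈ paravectors Q) : a * b * a ∈ paravectors Q := by
  obtain ⟨c, hc⟩ := exists_mul_add_star_mul_star ha hb
  obtain ⟨d, hd⟩ := exists_star_mul_self_of_mem_paravectors ha
  have h : a * b * a = c • a - d • star b := by
    rw [eq_sub_of_add_eq hc, sub_mul, mul_assoc (star b), hd, ← Algebra.commutes,
      ← Algebra.smul_def, ← Algebra.smul_def]
  rw [h]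
  exact sub_mem (Submodule.smul_mem _ _ ha) (Submodule.smul_mem _ _ (star_mem_paravectors hb))

/-- The products of paravectors. As `0` is a paravector, for `negForm m` they comprise the possible
entries `cliffordGroup m ∪ {0}` of a matrix in `SLplus m`. -/
def paravectorProducts (Q : QuadraticForm R V) : Submonoid (CliffordAlgebra Q) :=
  Submonoid.closure (paravectors Q)

theorem exists_star_mul_self {a : CliffordAlgebra Q} (ha : a ∈ paravectorProducts Q) :
    ∃ c : R, star a * a = algebraMap R _ c := by
  induction ha using Submonoid.closure_induction with
  | mem a ha => exact exists_star_mul_self_of_mem_paravectors ha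
  | one => exact ⟨1, by simp⟩
  | mul a b _ _ iha ihb =>
    obtain ⟨c, hc⟩ := iha
    obtain ⟨d, hd⟩ := ihb
    refine ⟨c * d, ?_⟩
    rw [star_mul, mul_assoc, ← mul_assoc (star a), hc, Algebra.left_comm, hd, map_mul]

theorem star_mul_mul_involute_mem_paravectors {a b : CliffordAlgebra Q}
    (ha : a ∈ paravectorProducts Q) (hb : b ∈ paravectors Q) :
    star a * b * involute a ∈ paravectors Q := by
  induction ha using Submonoid.closure_induction generalizing b with
  | mem a ha =>
    have h : involute a = star a := by
      rw [star_def', reverse_of_mem_paravectors ha]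
    rw [h]
    exact mul_mul_self_mem_paravectors (star_mem_paravectors ha) hb
  | one => simpa
  | mul a c _ _ iha ihc =>
    have h := ihc (iha hb)
    simpa only [star_mul, map_mul, mul_assoc] using h

end Paravectors

variable {m : ℕ}

/-! ### The Euclidean inner product -/

/-- The Euclidean inner product of `Cliff m`, for which the monomials are orthonormal. -/
def innerForm (m : ℕ) : LinearMap.BilinForm ℝ (Cliff m) := (basis m).toDual

theorem innerForm_monomial (I J : Finset (Fin m)) :
    innerForm m (monomial m I) (monomial m J) = if I = J then 1 else 0 := by
  rw [← basis_apply, ← basis_apply, innerForm, Module.Basis.toDual_apply]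

theorem innerForm_monomial_right (a : Cliff m) (I : Finset (Fin m)) :
    innerForm m a (monomial m I) = coeff I a := by
  rw [← basis_apply, innerForm, Module.Basis.toDual_eq_repr, coeff]

theorem innerForm_monomial_left (I : Finset (Fin m)) (a : Cliff m) :
    innerForm m (monomial m I) a = coeff I a := by
  rw [← basis_apply, innerForm, Module.Basis.toDual_apply_right, coeff]

theorem innerForm_comm (a b : Cliff m) : innerForm m a b = innerForm m b a := by
  have h : innerForm m = (innerForm m).flip := by
    refine LinearMap.ext_basis (basis m) (basis m) fun I J => ?_
    change innerForm m (basis m I) (basis m J) = innerForm m (basis m J) (basis m I)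
    simp only [basis_apply, innerForm_monomial, eq_comm]
  exact LinearMap.congr_fun₂ h a b

theorem innerForm_self (a : Cliff m) : innerForm m a a = normSq a := by
  conv_lhs => rw [← (basis m).sum_repr a, map_sum, (basis m).sum_repr a]
  simp only [map_smul, basis_apply, innerForm_monomial_right, smul_eq_mul, normSq, coeff, sq]

theorem normSq_nonneg (a : Cliff m) : 0 ≤ normSq a :=
  Finset.sum_nonneg fun _ _ => sq_nonneg _

theorem normSq_zero : normSq (0 : Cliff m) = 0 := by
  rw [← innerForm_self, map_zero]

theorem normSq_eq_zero_iff {a : Cliff m} : normSq a = 0 ↔ a = 0 := by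
  refine ⟨fun h => (basis m).ext_elem fun I => ?_, fun h => h ▸ normSq_zero⟩
  have hI : coeff I a ^ 2 = 0 :=
    (Finset.sum_eq_zero_iff_of_nonneg fun _ _ => sq_nonneg _).1 h I (Finset.mem_univ I)
  simpa [coeff] using hI

theorem normSq_smul (c : ℝ) (a : Cliff m) : normSq (c • a) = c ^ 2 * normSq a := by
  simp only [← innerForm_self, map_smul, LinearMap.smul_apply, smul_eq_mul]
  ring

theorem normSq_neg (a : Cliff m) : normSq (-a) = normSq a := by
  simp only [← innerForm_self, map_neg, LinearMap.neg_apply, neg_neg]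

theorem normSq_sub (a b : Cliff m) :
    normSq (a - b) = normSq a - 2 * innerForm m a b + normSq b := by
  simp only [← innerForm_self, map_sub, LinearMap.sub_apply, innerForm_comm b a]
  ring

theorem monomial_empty : monomial m ∅ = 1 := by simp [monomial]

theorem monomial_singleton (k : Fin m) : monomial m {k} = gen m k := by simp [monomial]

theorem re_eq_innerForm_one (a : Cliff m) : re a = innerForm m 1 a := by
  rw [← monomial_empty, innerForm_monomial_left, re]

theorem normSq_one : normSq (1 : Cliff m) = 1 := by
  rw [← innerForm_self, ← monomial_empty, innerForm_monomial, if_pos rfl]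

theorem re_algebraMap (r : ℝ) : re (algebraMap ℝ (Cliff m) r) = r := by
  rw [re_eq_innerForm_one, Algebra.algebraMap_eq_smul_one, map_smul, innerForm_self, normSq_one,
    smul_eq_mul, mul_one]

theorem exists_prod_gen_eq_smul_of_perm {l₁ l₂ : List (Fin m)} (h : l₁.Perm l₂) :
    ∃ ε : ℝ, ε * ε = 1 ∧ (l₁.map (gen m)).prod = ε • (l₂.map (gen m)).prod := by
  induction h with
  | nil => exact ⟨1, by simp⟩
  | cons k _ ih =>
    obtain ⟨ε, hε, h⟩ := ih
    exact ⟨ε, hε, by simp [h]⟩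
  | swap j k l =>
    rcases eq_or_ne k j with rfl | hkj
    · exact ⟨1, by simp⟩
    · exact ⟨-1, by simp, by simp [← mul_assoc, gen_anticomm m k j hkj]⟩
  | trans _ _ ih₁ ih₂ =>
    obtain ⟨ε₁, hε₁, h₁⟩ := ih₁
    obtain ⟨ε₂, hε₂, h₂⟩ := ih₂
    exact ⟨ε₁ * ε₂, by rw [mul_mul_mul_comm, hε₁, hε₂, one_mul], by rw [h₁, h₂, smul_smul]⟩

theorem exists_gen_mul_monomial_of_notMem {k : Fin m} {I : Finset (Fin m)} (hk : k ∉ I) :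
    ∃ ε : ℝ, ε * ε = 1 ∧ gen m k * monomial m I = ε • monomial m (insert k I) := by
  have hperm : (k :: I.sort (· ≤ ·)).Perm ((insert k I).sort (· ≤ ·)) :=
    ((I.sort_perm_toList _).cons k).trans
      ((Finset.toList_insert hk).symm.trans (Finset.sort_perm_toList _ _).symm)
  simpa [monomial] using exists_prod_gen_eq_smul_of_perm hperm

theorem gen_mul_gen_mul (k : Fin m) (a : Cliff m) : gen m k * (gen m k * a) = -a := by
  rw [← mul_assoc, gen_sq, neg_one_mul]

theorem exists_gen_mul_monomial (k : Fin m) (I : Finset (Fin m)) :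
    ∃ ε : ℝ, ε * ε = 1 ∧ gen m k * monomial m I = ε • monomial m (I ∆ {k}) := by
  by_cases hk : k ∈ I
  · obtain ⟨ε, hε, h⟩ := exists_gen_mul_monomial_of_notMem (Finset.notMem_erase k I)
    rw [Finset.insert_erase hk] at h
    refine ⟨-ε, by rwa [neg_mul_neg], ?_⟩
    have hI : I ∆ {k} = I.erase k := by ext; grind [Finset.mem_symmDiff]
    have hmon : monomial m I = ε • (gen m k * monomial m (I.erase k)) := by
      rw [h, smul_smul, hε, one_smul]
    rw [hI, hmon, mul_smul_comm, gen_mul_gen_mul, neg_smul, smul_neg]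
  · have hI : I ∆ {k} = insert k I := by ext; grind [Finset.mem_symmDiff]
    exact hI ▸ exists_gen_mul_monomial_of_notMem hk

theorem innerForm_gen_mul_gen_mul (k : Fin m) (a b : Cliff m) :
    innerForm m (gen m k * a) (gen m k * b) = innerForm m a b := by
  choose ε hε hgen using exists_gen_mul_monomial (m := m) k
  have h : (innerForm m).compl₁₂ (LinearMap.mulLeft ℝ (gen m k)) (LinearMap.mulLeft ℝ (gen m k))
      = innerForm m := by
    refine LinearMap.ext_basis (basis m) (basis m) fun I J => ?_
    rw [LinearMap.compl₁₂_apply, LinearMap.mulLeft_apply, LinearMap.mulLeft_apply, basis_apply,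
      basis_apply, hgen, hgen, map_smul, map_smul, LinearMap.smul_apply, innerForm_monomial,
      innerForm_monomial]
    rcases eq_or_ne I J with rfl | hIJ
    · rw [if_pos rfl, if_pos rfl, smul_smul, hε, one_smul]
    · rw [if_neg hIJ, if_neg (symmDiff_left_injective {k} |>.ne hIJ), smul_zero, smul_zero]
  exact LinearMap.congr_fun₂ h a b

theorem innerForm_gen_mul (k : Fin m) (a b : Cliff m) :
    innerForm m (gen m k * a) b = -innerForm m a (gen m k * b) := by
  rw [← innerForm_gen_mul_gen_mul k, gen_mul_gen_mul, map_neg, LinearMap.neg_apply]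

theorem ι_eq_sum_gen (w : Fin m → ℝ) : ι (negForm m) w = ∑ k, w k • gen m k := by
  conv_lhs => rw [pi_eq_sum_univ' w]
  simp only [map_sum, map_smul, gen]

theorem star_gen (k : Fin m) : star (gen m k) = -gen m k := star_ι _

theorem involute_gen (k : Fin m) : involute (gen m k) = -gen m k := involute_ι _

theorem innerForm_mul_left (c a b : Cliff m) :
    innerForm m (c * a) b = innerForm m a (star c * b) := by
  induction c using CliffordAlgebra.induction generalizing a b with
  | algebraMap r => simp [← Algebra.smul_def]
  | ι w => simp [ι_eq_sum_gen, Finset.sum_mul, innerForm_gen_mul, star_gen]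
  | mul x y hx hy => rw [mul_assoc, hx, hy, star_mul, mul_assoc]
  | add x y hx hy => simp [add_mul, hx, hy]

theorem conj_eq_star (a : Cliff m) : conj a = star a := rfl

theorem re_conj_mul (a b : Cliff m) : re (conj a * b) = innerForm m a b := by
  rw [re_eq_innerForm_one, conj_eq_star, ← innerForm_mul_left, mul_one]

/-! ### Clifford vectors and products of Clifford vectors -/

theorem vectors_eq_paravectors (m : ℕ) : vectors m = paravectors (negForm m) := by
  have hgen : Set.range (gen m) = ι (negForm m) '' Set.range (Pi.basisFun ℝ (Fin m)) := by
    rw [← Set.range_comp]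
    exact congrArg Set.range (funext fun k => by simp [gen])
  rw [vectors, Submodule.span_insert, hgen, Submodule.span_image, Module.Basis.span_eq,
    Submodule.map_top, paravectors, Submodule.one_eq_span]

theorem mem_paravectorProducts {a : Cliff m} (ha : a ∈ cliffordGroup m ∨ a = 0) :
    a ∈ paravectorProducts (negForm m) := by
  rcases ha with ha | rfl
  · refine Submonoid.closure_mono (fun b hb => ?_) ha
    exact vectors_eq_paravectors m ▸ hb.1
  · exact Submonoid.subset_closure (zero_mem _)

theorem conj_mul_self {a : Cliff m} (ha : a ∈ paravectorProducts (negForm m)) :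
    conj a * a = algebraMap ℝ _ (normSq a) := by
  obtain ⟨c, hc⟩ := exists_star_mul_self ha
  rw [← innerForm_self, ← re_conj_mul, conj_eq_star, hc, re_algebraMap]

theorem rev_mul_prim {a : Cliff m} (ha : a ∈ paravectorProducts (negForm m)) :
    rev a * prim a = algebraMap ℝ _ (normSq a) := by
  have h := congrArg prim (conj_mul_self ha)
  simpa [prim, conj, rev, reverse_involute] using h

theorem rev_of_mem_vectors {a : Cliff m} (ha : a ∈ vectors m) : rev a = a :=
  reverse_of_mem_paravectors (vectors_eq_paravectors m ▸ ha)

theorem rev_mul_prim_mem_vectors {a b : Cliff m} (ha : a ∈ paravectorProducts (negForm m))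
    (hab : a * rev b ∈ vectors m) : rev b * prim a ∈ vectors m := by
  rcases eq_or_ne a 0 with rfl | ha0
  · simp [prim]
  rw [vectors_eq_paravectors] at hab ⊢
  have h : conj a * (a * rev b) * prim a ∈ paravectors (negForm m) :=
    star_mul_mul_involute_mem_paravectors ha hab
  rw [← mul_assoc, conj_mul_self ha, mul_assoc, ← Algebra.smul_def] at h
  exact (Submodule.smul_mem_iff _ (mt normSq_eq_zero_iff.1 ha0)).1 h

/-! ### Points of the upper half-space -/

theorem incl_monomial (I : Finset (Fin m)) :
    incl (monomial m I) = monomial (m + 1) (I.map Fin.castSuccEmb) := by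
  rw [monomial, monomial, map_list_prod, List.map_map,
    ← (Fin.strictMono_castSucc.strictMonoOn _).map_finsetSort, List.map_map]
  exact congrArg List.prod (List.map_congr_left fun k _ => incl_gen m k)

theorem innerForm_incl (a b : Cliff m) :
    innerForm (m + 1) (incl a) (incl b) = innerForm m a b := by
  have h : (innerForm (m + 1)).compl₁₂ incl.toLinearMap incl.toLinearMap = innerForm m := by
    refine LinearMap.ext_basis (basis m) (basis m) fun I J => ?_
    simp only [LinearMap.compl₁₂_apply, AlgHom.toLinearMap_apply, basis_apply, incl_monomial,
      innerForm_monomial, Finset.map_inj]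
  exact LinearMap.congr_fun₂ h a b

theorem innerForm_incl_lastGen (a : Cliff m) : innerForm (m + 1) (incl a) (lastGen m) = 0 := by
  have h : (innerForm (m + 1)).flip (lastGen m) ∘ₗ incl.toLinearMap = 0 := by
    refine (basis m).ext fun I => ?_
    have hI : I.map Fin.castSuccEmb ≠ {Fin.last m} := fun h =>
      absurd (h ▸ Finset.mem_singleton_self (Fin.last m)) (by simp [Fin.castSucc_ne_last])
    change innerForm (m + 1) (incl (basis m I)) (lastGen m) = 0
    rw [basis_apply, incl_monomial, lastGen, ← monomial_singleton, innerForm_monomial, if_neg hI]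
  exact LinearMap.congr_fun h a

theorem incl_injective : Function.Injective (incl (m := m)) := by
  refine (injective_iff_map_eq_zero _).2 fun a ha => ?_
  rw [← normSq_eq_zero_iff, ← innerForm_self, ← innerForm_incl, ha, map_zero]

theorem normSq_lastGen (m : ℕ) : normSq (lastGen m) = 1 := by
  rw [← innerForm_self, lastGen, ← monomial_singleton, innerForm_monomial, if_pos rfl]

theorem height_eq_innerForm (z : Cliff (m + 1)) : height z = innerForm (m + 1) z (lastGen m) := by
  rw [height, lastGen, ← monomial_singleton, innerForm_monomial_right]

/-- The point `x + t i_n`, written in the coordinates of the half-space model: `t` is its height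
above the boundary and `x` its projection to the boundary if `x` is a vector. -/
def point (x : Cliff m) (t : ℝ) : Cliff (m + 1) := incl x + t • lastGen m

theorem point_zero_one (m : ℕ) : point (0 : Cliff m) 1 = lastGen m := by
  rw [point, map_zero, zero_add, one_smul]

theorem point_zero (x : Cliff m) : point x 0 = incl x := by
  rw [point, zero_smul, add_zero]

theorem point_sub (x y : Cliff m) (t u : ℝ) :
    point x t - point y u = point (x - y) (t - u) := by
  rw [point, point, point, map_sub, sub_smul, add_sub_add_comm]

theorem innerForm_point (x y : Cliff m) (t u : ℝ) :
    innerForm (m + 1) (point x t) (point y u) = innerForm m x y + t * u := by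
  simp only [point, map_add, map_smul, LinearMap.add_apply, LinearMap.smul_apply, smul_eq_mul,
    innerForm_incl, innerForm_incl_lastGen, innerForm_comm (lastGen m) (incl y), innerForm_self,
    normSq_lastGen]
  ring

theorem normSq_point (x : Cliff m) (t : ℝ) : normSq (point x t) = normSq x + t ^ 2 := by
  rw [← innerForm_self, innerForm_point, innerForm_self, sq]

theorem height_point (x : Cliff m) (t : ℝ) : height (point x t) = t := by
  rw [height_eq_innerForm, ← point_zero_one, innerForm_point, map_zero, zero_add, mul_one]

theorem point_inj {x y : Cliff m} {t u : ℝ} : point x t = point y u ↔ x = y ∧ t = u := by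
  rw [← sub_eq_zero, ← normSq_eq_zero_iff, point_sub, normSq_point,
    add_eq_zero_iff_of_nonneg (normSq_nonneg _) (sq_nonneg _), normSq_eq_zero_iff, sq_eq_zero_iff,
    sub_eq_zero, sub_eq_zero]

theorem vectors_succ (m : ℕ) :
    vectors (m + 1) = (vectors m).map incl.toLinearMap ⊔ Submodule.span ℝ {lastGen m} := by
  have hrange : Set.range (gen (m + 1)) = incl '' Set.range (gen m) ∪ {lastGen m} := by
    ext z
    simp [Fin.exists_fin_succ', incl_gen, lastGen, eq_comm, or_comm]
  rw [vectors, hrange, vectors, Submodule.map_span, ← Submodule.span_union,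
    AlgHom.coe_toLinearMap, Set.image_insert_eq, map_one, Set.insert_union]

theorem mem_vectors_succ_iff {z : Cliff (m + 1)} :
    z ∈ vectors (m + 1) ↔ ∃ x ∈ vectors m, ∃ t, point x t = z := by
  simp [vectors_succ, Submodule.mem_sup, Submodule.mem_span_singleton, point]

theorem point_mem_upperHalfSpace {x : Cliff m} (hx : x ∈ vectors m) {t : ℝ} :
    point x t ∈ upperHalfSpace m ↔ 0 < t := by
  change _ ∧ _ ↔ _
  rw [height_point, and_iff_right (mem_vectors_succ_iff.2 ⟨x, hx, t, rfl⟩)]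

theorem sep_upperHalfSpace_ext {p q : Cliff (m + 1) → Prop}
    (h : ∀ x ∈ vectors m, ∀ t > 0, (p (point x t) ↔ q (point x t))) :
    {z ∈ upperHalfSpace m | p z} = {z ∈ upperHalfSpace m | q z} := by
  refine Set.sep_ext_iff.2 fun z hz => ?_
  obtain ⟨x, hx, t, rfl⟩ := mem_vectors_succ_iff.1 hz.1
  exact h x hx t ((point_mem_upperHalfSpace hx).1 hz)

theorem one_mem_vectors (m : ℕ) : (1 : Cliff m) ∈ vectors m :=
  Submodule.subset_span (Set.mem_insert _ _)

/-! ### The bisector of two points -/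

/-- The hyperbolic bisector of two points; `bisector M p` is `equidistant p (mobius M p)`. -/
def equidistant (p q : Cliff (m + 1)) : Set (Cliff (m + 1)) :=
  {z ∈ upperHalfSpace m | hypDist p z = hypDist z q}

theorem hypDist_point (x y : Cliff m) (t u : ℝ) :
    hypDist (point x t) (point y u)
      = Real.arcosh (1 + (normSq (x - y) + (t - u) ^ 2) / (2 * t * u)) := by
  rw [hypDist, point_sub, normSq_point, height_point, height_point]

theorem hypDist_point_eq_iff (x y a : Cliff m) {t u b : ℝ} (ht : 0 < t) (hu : 0 < u)
    (hb : 0 < b) :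
    hypDist (point x t) (point y u) = hypDist (point y u) (point a b) ↔
      (normSq (x - y) + (t - u) ^ 2) * b = (normSq (y - a) + (u - b) ^ 2) * t := by
  have hxy := normSq_nonneg (x - y)
  have hya := normSq_nonneg (y - a)
  rw [hypDist_point, hypDist_point,
    Real.arcosh_injOn.eq_iff (Set.mem_Ici.2 (le_add_of_nonneg_right (by positivity)))
      (Set.mem_Ici.2 (le_add_of_nonneg_right (by positivity))),
    add_right_inj, div_eq_div_iff (by positivity) (by positivity)]
  constructor <;> intro h
  · refine mul_left_cancel₀ (mul_pos two_pos hu).ne' ?_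
    linear_combination h
  · linear_combination 2 * u * h

theorem mul_normSq_sub_sub_mul_normSq_sub (w x y : Cliff m) {t u : ℝ} (htu : t ≠ u) :
    t * normSq (w - y) - u * normSq (x - w)
      = (t - u) * (normSq (w - (t - u)⁻¹ • (t • y - u • x))
          - t * u * normSq ((t - u)⁻¹ • (y - x))) := by
  have hd := sub_ne_zero.2 htu
  simp only [normSq_sub, normSq_smul, map_smul, map_sub, LinearMap.smul_apply, smul_eq_mul,
    innerForm_comm x w]
  field_simp
  ring

theorem equidistant_eq_halfSphere (x y : Cliff m) {t u : ℝ} (ht : 0 < t) (hu : 0 < u)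
    (htu : t ≠ u) :
    equidistant (point x t) (point y u)
      = halfSphere ((t - u)⁻¹ • (t • y - u • x))
          √(t * u * (1 + normSq ((t - u)⁻¹ • (y - x)))) := by
  refine sep_upperHalfSpace_ext fun w _ r hr => ?_
  have hnorm := normSq_nonneg ((t - u)⁻¹ • (y - x))
  have hapollonius := mul_normSq_sub_sub_mul_normSq_sub w x y htu
  rw [hypDist_point_eq_iff _ _ _ ht hr hu, ← point_zero, point_sub, normSq_point,
    Real.sq_sqrt (by positivity)]
  constructor <;> intro H
  · refine mul_left_cancel₀ (sub_ne_zero.2 htu) ?_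
    linear_combination -H - hapollonius
  · linear_combination -(t - u) * H - hapollonius

theorem isHalfSphere_equidistant {x y : Cliff m} (hx : x ∈ vectors m) (hy : y ∈ vectors m)
    {t u : ℝ} (ht : 0 < t) (hu : 0 < u) (htu : t ≠ u) :
    IsHalfSphere (equidistant (point x t) (point y u)) := by
  refine ⟨_, ?_, _, ?_, equidistant_eq_halfSphere x y ht hu htu⟩
  · exact Submodule.smul_mem _ _
      (sub_mem (Submodule.smul_mem _ _ hy) (Submodule.smul_mem _ _ hx))
  · have hnorm := normSq_nonneg ((t - u)⁻¹ • (y - x))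
    positivity

theorem equidistant_eq_hyperplane (x y : Cliff m) {t : ℝ} (ht : 0 < t) :
    equidistant (point x t) (point y t)
      = {z ∈ upperHalfSpace m |
          re (conj (incl (y - x)) * z) = (normSq y - normSq x) / 2} := by
  refine sep_upperHalfSpace_ext fun w _ r hr => ?_
  rw [hypDist_point_eq_iff _ _ _ ht hr ht, re_conj_mul, ← point_zero, innerForm_point, normSq_sub,
    normSq_sub, map_sub, LinearMap.sub_apply, innerForm_comm w y, mul_left_inj' ht.ne']
  constructor <;> intro H <;> linarith

theorem isHyperplane_equidistant {x y : Cliff m} (hx : x ∈ vectors m) (hy : y ∈ vectors m)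
    (hxy : x ≠ y) {t : ℝ} (ht : 0 < t) : IsHyperplane (equidistant (point x t) (point y t)) := by
  have hmid : (2⁻¹ : ℝ) • (x + y) ∈ vectors m := Submodule.smul_mem _ _ (add_mem hx hy)
  refine ⟨⟨point ((2⁻¹ : ℝ) • (x + y)) t, (point_mem_upperHalfSpace hmid).2 ht, ?_⟩,
    incl (y - x), mem_vectors_succ_iff.2 ⟨y - x, sub_mem hy hx, 0, point_zero _⟩, ?_, _,
    equidistant_eq_hyperplane x y ht⟩
  · have h : x - (2⁻¹ : ℝ) • (x + y) = (2⁻¹ : ℝ) • (x + y) - y := by module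
    rw [hypDist_point_eq_iff _ _ _ ht ht ht, h]
  · rw [Ne, map_eq_zero_iff _ incl_injective, sub_eq_zero]
    exact hxy.symm

theorem not_isHyperplane_halfSphere {c : Cliff m} (hc : c ∈ vectors m) {R : ℝ} (hR : 0 < R) :
    ¬ IsHyperplane (halfSphere c R) := by
  rintro ⟨-, u, -, -, t₀, h⟩
  have hx (r : ℝ) : c + r • 1 ∈ vectors m :=
    add_mem hc (Submodule.smul_mem _ _ (one_mem_vectors m))
  have hmem (r t : ℝ) (ht : 0 < t) : r ^ 2 + t ^ 2 = R ^ 2 ↔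
      innerForm (m + 1) u (incl c) + r * innerForm (m + 1) u 1
        + t * innerForm (m + 1) u (lastGen m) = t₀ := by
    have hz := (point_mem_upperHalfSpace (hx r)).2 ht
    have hiff := Set.sep_ext_iff.1 h _ hz
    rwa [← point_zero, point_sub, normSq_point, add_sub_cancel_left, normSq_smul, normSq_one,
      mul_one, sub_zero, re_conj_mul, point, map_add, map_add, map_add, map_smul, map_smul,
      map_one, map_smul] at hiff
  -- Three points of the sphere show that the linear functional does not depend on the height, so
  -- that the hyperplane contains the point at height `2 R` above the centre, outside the sphere.
  have htop := (hmem 0 R hR).1 (by ring)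
  have hright := (hmem (3 / 5 * R) (4 / 5 * R) (by positivity)).1 (by ring)
  have hleft := (hmem (-(3 / 5 * R)) (4 / 5 * R) (by positivity)).1 (by ring)
  have habove := (hmem 0 (2 * R) (by positivity)).2 (by linarith)
  nlinarith

theorem IsHalfSphere.not_isHyperplane {S : Set (Cliff (m + 1))} (hS : IsHalfSphere S) :
    ¬ IsHyperplane S := by
  obtain ⟨c, hc, R, hR, rfl⟩ := hS
  exact not_isHyperplane_halfSphere hc hR

theorem isHyperplane_equidistant_iff {x y : Cliff m} (hx : x ∈ vectors m) (hy : y ∈ vectors m)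
    {t u : ℝ} (ht : 0 < t) (hu : 0 < u) (hne : point x t ≠ point y u) :
    IsHyperplane (equidistant (point x t) (point y u)) ↔ t = u := by
  constructor
  · intro hplane
    by_contra htu
    exact (isHalfSphere_equidistant hx hy ht hu htu).not_isHyperplane hplane
  · rintro rfl
    exact isHyperplane_equidistant hx hy (fun h => hne (point_inj.2 ⟨h, rfl⟩)) ht

theorem isHalfSphere_equidistant_iff {x y : Cliff m} (hx : x ∈ vectors m) (hy : y ∈ vectors m)
    {t u : ℝ} (ht : 0 < t) (hu : 0 < u) (hne : point x t ≠ point y u) :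
    IsHalfSphere (equidistant (point x t) (point y u)) ↔ t ≠ u := by
  refine ⟨fun hS htu => hS.not_isHyperplane ?_, isHalfSphere_equidistant hx hy ht hu⟩
  exact (isHyperplane_equidistant_iff hx hy ht hu hne).2 htu

theorem equidistant_point_zero_one_eq_halfSphere (v : Cliff m) {s : ℝ} (hs : 0 < s) (hs1 : s ≠ 1) :
    equidistant (point 0 1) (point (-(s⁻¹ • v)) s⁻¹)
      = halfSphere (-((s - 1)⁻¹ • v)) √((1 + normSq (-((s - 1)⁻¹ • v))) / s) := by
  have hscalar : (1 - s⁻¹)⁻¹ * s⁻¹ = (s - 1)⁻¹ := by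
    rw [← mul_inv, sub_mul, one_mul, inv_mul_cancel₀ hs.ne']
  rw [equidistant_eq_halfSphere 0 _ one_pos (inv_pos.2 hs) (inv_ne_one.2 hs1).symm, one_smul,
    smul_zero, sub_zero, smul_neg, smul_smul, hscalar, one_mul, inv_mul_eq_div]

theorem equidistant_point_zero_one_eq_hyperplane (v : Cliff m) :
    equidistant (point 0 1) (point (-v) 1)
      = {z ∈ upperHalfSpace m | re (conj (incl v) * z) + normSq v / 2 = 0} := by
  rw [equidistant_eq_hyperplane 0 (-v) one_pos]
  refine Set.sep_ext_iff.2 fun z _ => ?_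
  rw [re_conj_mul, re_conj_mul, sub_zero, map_neg, map_neg, LinearMap.neg_apply, normSq_neg,
    normSq_zero, sub_zero, neg_eq_iff_add_eq_zero]

/-! ### The group `SL₊` -/

-- Finite dimension makes one-sided inverses in `Cliff m` and in its matrix ring two-sided.
instance finite_cliff (m : ℕ) : Module.Finite ℝ (Cliff m) := Module.Finite.of_basis (basis m)

instance isNoetherianRing_cliff (m : ℕ) : IsNoetherianRing (Cliff m) :=
  IsNoetherianRing.of_finite ℝ _

theorem ringInverse_eq_of_mul_eq_one {A : Type*} [MonoidWithZero A] [IsDedekindFiniteMonoid A]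
    {a b : A} (h : a * b = 1) : Ring.inverse a = b :=
  Ring.inverse_unit (⟨a, b, h, mul_eq_one_symm h⟩ : Aˣ)

theorem rev_mul (a b : Cliff m) : rev (a * b) = rev b * rev a := reverse.map_mul a b

theorem rev_rev (a : Cliff m) : rev (rev a) = a := reverse_reverse a

theorem prim_prim (a : Cliff m) : prim (prim a) = a := involute_involute a

theorem mul_rev_comm_of_mem_vectors {a b : Cliff m} (h : a * rev b ∈ vectors m) :
    b * rev a = a * rev b := by
  rw [← rev_of_mem_vectors h, rev_mul, rev_rev]

theorem lastGen_mul_incl (a : Cliff m) : lastGen m * incl a = incl (prim a) * lastGen m := by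
  induction a using CliffordAlgebra.induction with
  | algebraMap r => simp [prim, Algebra.commutes]
  | ι w =>
    simp only [prim, ι_eq_sum_gen, map_sum, map_smul, map_neg, involute_gen, incl_gen,
      Finset.mul_sum, Finset.sum_mul]
    refine Finset.sum_congr rfl fun k _ => ?_
    rw [mul_smul_comm, smul_mul_assoc, lastGen, gen_anticomm _ _ _ (Fin.castSucc_lt_last k).ne',
      neg_mul]
  | mul a b ha hb =>
    have h : prim (a * b) = prim a * prim b := map_mul involute a b
    rw [map_mul, ← mul_assoc, ha, mul_assoc, hb, h, map_mul, mul_assoc]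
  | add a b ha hb =>
    have h : prim (a + b) = prim a + prim b := map_add involute a b
    rw [map_add, mul_add, ha, hb, h, map_add, add_mul]

theorem affine_mul_affine (a b c d : Cliff m) :
    (incl a * lastGen m + incl b) * (incl c * lastGen m + incl d)
      = incl (a * prim d + b * c) * lastGen m + incl (b * d - a * prim c) := by
  have hquad : incl a * lastGen m * (incl c * lastGen m) = -(incl a * incl (prim c)) := by
    rw [mul_assoc, ← mul_assoc (lastGen m), lastGen_mul_incl, mul_assoc (incl (prim c)), lastGen,
      gen_sq, mul_neg_one, mul_neg]
  have hlin : incl a * lastGen m * incl d = incl a * incl (prim d) * lastGen m := by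
    rw [mul_assoc, lastGen_mul_incl, mul_assoc]
  rw [add_mul, mul_add, mul_add, hquad, hlin]
  simp only [map_add, map_sub, map_mul, add_mul, mul_assoc]
  abel

variable {α β γ δ : Cliff m}

theorem mul_eq_one_of_mem_SLplus (h : !![α, β; γ, δ] ∈ SLplus m) :
    !![α, β; γ, δ] * !![rev δ, -rev β; -rev γ, rev α] = 1 := by
  have hdet : α * rev δ - β * rev γ = 1 := h.2
  have hdet_rev : δ * rev α - γ * rev β = 1 := by simpa [rev] using congrArg rev hdet
  have hab : β * rev α = α * rev β := mul_rev_comm_of_mem_vectors h.1.vec_ab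
  have hcd : δ * rev γ = γ * rev δ := mul_rev_comm_of_mem_vectors h.1.vec_cd
  rw [Matrix.mul_fin_two, Matrix.one_fin_two]
  congr! 4
  · rw [mul_neg, ← sub_eq_add_neg, hdet]
  · rw [mul_neg, hab, neg_add_cancel]
  · rw [mul_neg, hcd, add_neg_cancel]
  · rw [mul_neg, neg_add_eq_sub, hdet_rev]

theorem rev_mul_sub_rev_mul_of_mem_SLplus (h : !![α, β; γ, δ] ∈ SLplus m) :
    rev δ * α - rev β * γ = 1 := by
  have hinv := mul_eq_one_symm (mul_eq_one_of_mem_SLplus h)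
  have h00 := congrFun (congrFun hinv 0) 0
  simpa [Matrix.mul_fin_two, ← sub_eq_add_neg] using h00

theorem rev_mul_comm_of_mem_SLplus (h : !![α, β; γ, δ] ∈ SLplus m) : rev α * γ = rev γ * α := by
  simpa [rev_mul, rev_rev] using rev_of_mem_vectors h.1.vec_ca

theorem rev_mul_prim_add_mem_vectors (h : !![α, β; γ, δ] ∈ SLplus m) :
    rev β * prim α + rev δ * prim γ ∈ vectors m :=
  add_mem (rev_mul_prim_mem_vectors (mem_paravectorProducts (h.1.entries 0 0)) h.1.vec_ab)
    (rev_mul_prim_mem_vectors (mem_paravectorProducts (h.1.entries 1 0)) h.1.vec_cd)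

theorem normSq_add_normSq_pos (h : !![α, β; γ, δ] ∈ SLplus m) : 0 < normSq α + normSq γ := by
  have hα := normSq_nonneg α
  have hγ := normSq_nonneg γ
  refine (add_nonneg hα hγ).lt_of_ne' fun h0 => ?_
  obtain ⟨hα0, hγ0⟩ := (add_eq_zero_iff_of_nonneg hα hγ).1 h0
  have hdet := rev_mul_sub_rev_mul_of_mem_SLplus h
  rw [normSq_eq_zero_iff.1 hα0, normSq_eq_zero_iff.1 hγ0, mul_zero, mul_zero, sub_zero] at hdet
  exact zero_ne_one hdet

theorem ringInverse_neg_rev_mul_lastGen_add_rev (h : !![α, β; γ, δ] ∈ SLplus m) :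
    Ring.inverse (incl (-rev γ) * lastGen m + incl (rev α))
      = (normSq α + normSq γ)⁻¹ • (incl γ * lastGen m + incl (prim α)) := by
  have hlin : -rev γ * prim (prim α) + rev α * γ = 0 := by
    rw [prim_prim, rev_mul_comm_of_mem_SLplus h, neg_mul, neg_add_cancel]
  have hα : α ∈ paravectorProducts (negForm m) := mem_paravectorProducts (h.1.entries 0 0)
  have hγ : γ ∈ paravectorProducts (negForm m) := mem_paravectorProducts (h.1.entries 1 0)
  have hconst : rev α * prim α - -rev γ * prim γ
      = algebraMap ℝ (Cliff m) (normSq α + normSq γ) := by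
    rw [neg_mul, sub_neg_eq_add, rev_mul_prim hα, rev_mul_prim hγ, ← map_add]
  refine ringInverse_eq_of_mul_eq_one ?_
  rw [mul_smul_comm, affine_mul_affine, hlin, hconst, map_zero, zero_mul, zero_add,
    AlgHom.commutes, Algebra.algebraMap_eq_smul_one, smul_smul,
    inv_mul_cancel₀ (normSq_add_normSq_pos h).ne', one_smul]

theorem mobius_inverse_lastGen (h : !![α, β; γ, δ] ∈ SLplus m) :
    mobius (Ring.inverse !![α, β; γ, δ]) (lastGen m)
      = point (-((normSq α + normSq γ)⁻¹ • (rev β * prim α + rev δ * prim γ)))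
          (normSq α + normSq γ)⁻¹ := by
  have hlin : rev δ * prim (prim α) + -rev β * γ = 1 := by
    rw [prim_prim, neg_mul, ← sub_eq_add_neg, rev_mul_sub_rev_mul_of_mem_SLplus h]
  have hconst : -rev β * prim α - rev δ * prim γ = -(rev β * prim α + rev δ * prim γ) := by
    rw [neg_mul, neg_add']
  rw [ringInverse_eq_of_mul_eq_one (mul_eq_one_of_mem_SLplus h)]
  change (incl (rev δ) * lastGen m + incl (-rev β)) *
    Ring.inverse (incl (-rev γ) * lastGen m + incl (rev α)) = _
  rw [ringInverse_neg_rev_mul_lastGen_add_rev h, mul_smul_comm, affine_mul_affine, hlin, hconst,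
    map_one, one_mul, smul_add, ← map_smul, smul_neg]
  exact add_comm _ _

theorem eq_rev_and_eq_neg_rev_of_vecMul_eq (h : !![α, β; γ, δ] ∈ SLplus m) {a b : Cliff m}
    (hrow : ![a, b] ᵥ* !![α, β; γ, δ] = ![1, 0]) : a = rev δ ∧ b = -rev β := by
  have hab : ![a, b] = ![1, 0] ᵥ* !![rev δ, -rev β; -rev γ, rev α] := by
    rw [← hrow, Matrix.vecMul_vecMul, mul_eq_one_of_mem_SLplus h, Matrix.vecMul_one]
  simpa [funext_iff, Fin.forall_fin_two, Matrix.vecMul_cons] using hab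

theorem mem_SUplus_of_mobius_inverse_lastGen_eq (h : !![α, β; γ, δ] ∈ SLplus m)
    (hfix : mobius (Ring.inverse !![α, β; γ, δ]) (lastGen m) = lastGen m) :
    !![α, β; γ, δ] ∈ SUplus m := by
  rw [mobius_inverse_lastGen h, ← point_zero_one, point_inj, inv_eq_one, neg_eq_zero,
    smul_eq_zero_iff_right (inv_ne_zero (normSq_add_normSq_pos h).ne')] at hfix
  obtain ⟨hv, hs⟩ := hfix
  have hα : α ∈ paravectorProducts (negForm m) := mem_paravectorProducts (h.1.entries 0 0)
  have hγ : γ ∈ paravectorProducts (negForm m) := mem_paravectorProducts (h.1.entries 1 0)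
  have hone : conj α * α + conj γ * γ = 1 := by
    rw [conj_mul_self hα, conj_mul_self hγ, ← map_add, hs, map_one]
  have hzero : conj α * β + conj γ * δ = 0 := by
    simpa [rev, conj, prim] using congrArg rev hv
  obtain ⟨hδ, hβ⟩ := eq_rev_and_eq_neg_rev_of_vecMul_eq h (a := conj α) (b := conj γ) (by
    simp [Matrix.vecMul_cons, hone, hzero])
  have hδ' : prim α = δ := by rw [← rev_rev δ, ← hδ, conj, rev_rev]
  have hγ' : -prim β = γ := by
    have hγβ := congrArg (prim ∘ rev) hβ
    simpa [prim, rev, conj, neg_eq_iff_eq_neg] using hγβ.symm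
  exact ⟨h, α, β, h.1.entries 0 0, h.1.entries 0 1, by rw [hγ', hδ']⟩

theorem bisector_ringInverse_lastGen (h : !![α, β; γ, δ] ∈ SLplus m) :
    bisector (Ring.inverse !![α, β; γ, δ]) (lastGen m)
      = equidistant (point 0 1)
          (point (-((normSq α + normSq γ)⁻¹ • (rev β * prim α + rev δ * prim γ)))
            (normSq α + normSq γ)⁻¹) := by
  rw [← mobius_inverse_lastGen h, point_zero_one]
  rfl

end VahlenBisector

end

theorem mainTheorem2 (m : ℕ) (α β γ δ : VahlenBisector.Cliff m)
    (M : Matrix (Fin 2) (Fin 2) (VahlenBisector.Cliff m))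
    (hM : M = !![α, β; γ, δ])
    (hSL : M ∈ VahlenBisector.SLplus m)
    (hSU : M ∉ VahlenBisector.SUplus m)
    (s : ℝ) (hs : s = VahlenBisector.normSq α + VahlenBisector.normSq γ)
    (v : VahlenBisector.Cliff m)
    (hv : v = VahlenBisector.rev β * VahlenBisector.prim α
      + VahlenBisector.rev δ * VahlenBisector.prim γ)
    (P : VahlenBisector.Cliff m) (hP : P = -((s - 1)⁻¹ • v))
    (S : Set (VahlenBisector.Cliff (m + 1)))
    (hS : S = VahlenBisector.bisector (Ring.inverse M) (VahlenBisector.lastGen m)) :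
    v ∈ VahlenBisector.vectors m ∧
    (VahlenBisector.IsHalfSphere S ↔ s ≠ 1) ∧
    (s ≠ 1 → P ∈ VahlenBisector.vectors m ∧
      ∃ R : ℝ, 0 < R ∧ R ^ 2 = (1 + VahlenBisector.normSq P) / s ∧
        S = VahlenBisector.halfSphere P R) ∧
    (VahlenBisector.IsHyperplane S ↔ s = 1) ∧
    (s = 1 → S = {z ∈ VahlenBisector.upperHalfSpace m |
      VahlenBisector.re (VahlenBisector.conj (VahlenBisector.incl v) * z)
        + VahlenBisector.normSq v / 2 = 0}) := by
  subst hM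
  have hs_pos : 0 < s := hs ▸ VahlenBisector.normSq_add_normSq_pos hSL
  have hv_mem : v ∈ VahlenBisector.vectors m :=
    hv ▸ VahlenBisector.rev_mul_prim_add_mem_vectors hSL
  have hq_mem : -(s⁻¹ • v) ∈ VahlenBisector.vectors m := neg_mem (Submodule.smul_mem _ _ hv_mem)
  have hP_norm := VahlenBisector.normSq_nonneg P
  have hne : VahlenBisector.point 0 1 ≠ VahlenBisector.point (-(s⁻¹ • v)) s⁻¹ := fun h =>
    hSU (VahlenBisector.mem_SUplus_of_mobius_inverse_lastGen_eq hSL (by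
      rw [VahlenBisector.mobius_inverse_lastGen hSL, ← hs, ← hv, ← h,
        VahlenBisector.point_zero_one]))
  rw [VahlenBisector.bisector_ringInverse_lastGen hSL, ← hs, ← hv] at hS
  refine ⟨hv_mem, ?_, fun hs1 => ⟨?_, √((1 + VahlenBisector.normSq P) / s), by positivity,
    Real.sq_sqrt (by positivity), ?_⟩, ?_, fun hs1 => ?_⟩
  · rw [hS, VahlenBisector.isHalfSphere_equidistant_iff (zero_mem _) hq_mem one_pos
      (inv_pos.2 hs_pos) hne, ne_comm, Ne, inv_eq_one]
  · exact hP ▸ neg_mem (Submodule.smul_mem _ _ hv_mem)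
  · rw [hS, hP, VahlenBisector.equidistant_point_zero_one_eq_halfSphere v hs_pos hs1]
  · rw [hS, VahlenBisector.isHyperplane_equidistant_iff (zero_mem _) hq_mem one_pos
      (inv_pos.2 hs_pos) hne, eq_comm, inv_eq_one]
  · rw [hS, hs1, inv_one, one_smul, VahlenBisector.equidistant_point_zero_one_eq_hyperplane]
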